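/- A mixed graph $G=(V,E\cup A)$ consists of a finite vertex set $V$, a finite set $E$ of undirected edges, each with two distinct endpoints in $V$, and a finite set $A$ of directed arcs, each with a tail and a head that are distinct vertices of $V$; parallel edges and arcs are allowed. A mixed edge cover of $G$ is a subset $F\subseteq E\cup A$ such that for every $v\in V$ there is a directed path (possibly of length $0$) using only arcs of $F\cap A$ from an endpoint of some edge $e\in F\cap E$ to $v$. Theorem. Let $k$ be a nonnegative integer and let $G=(V,E\cup A)$ be a mixed graph such that $E\cup A$ can be partitioned into $k$ mixed edge covers. Then $E\cup A$ can be partitioned into $k$ mixed edge covers $F_1,\dots,F_k$ such that, writing $N_i=F_i\cap E$ and $B_i=F_i\cap A$, for all $i,j\in\{1,\dots,k\}$ $$\bigl||F_i|-|F_j|\bigr|\le 2,\qquad \bigl||N_i|-|N_j|\bigr|\le 1,\qquad \bigl||B_i|-|B_j|\bigr|\le 2.$$ (A partition into $k$ parts means a family of $k$ pairwise disjoint sets with union $E\cup A$.) -/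

import Mathlib

/-- A mixed graph with vertex type `V`, undirected edges indexed by `E` and directed arcs
indexed by `A`. Parallel edges and arcs are allowed, loops are not. -/
structure MixedGraph (V E A : Type*) where
  /-- the unordered pair of endpoints of an undirected edge -/
  ends : E → Sym2 V
  /-- the tail of an arc -/
  tail : A → V
  /-- the head of an arc -/
  head : A → V
  ends_not_isDiag : ∀ e, ¬ (ends e).IsDiag
  tail_ne_head : ∀ a, tail a ≠ head a

namespace MixedGraph

variable {V E A : Type*}

/-- The edge part `F ∩ E` of a set `F` of edges and arcs. -/
def edgePart (F : Set (E ⊕ A)) : Set E := {e | Sum.inl e ∈ F}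

/-- The arc part `F ∩ A` of a set `F` of edges and arcs. -/
def arcPart (F : Set (E ⊕ A)) : Set A := {a | Sum.inr a ∈ F}

/-- There is a directed path (possibly of length `0`) from `u` to `v` all of whose arcs
lie in `B`. -/
def Reachable (G : MixedGraph V E A) (B : Set A) (u v : V) : Prop :=
  Relation.ReflTransGen (fun x y => ∃ a ∈ B, G.tail a = x ∧ G.head a = y) u v

/-- `F` is a mixed edge cover of `G`: every vertex is reachable, along arcs of `F`, from an
endpoint of some undirected edge of `F`. -/
def IsMixedEdgeCover (G : MixedGraph V E A) (F : Set (E ⊕ A)) : Prop :=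
  ∀ v : V, ∃ e ∈ edgePart F, ∃ u ∈ G.ends e, G.Reachable (arcPart F) u v

/-- The family `F` partitions the set of all edges and arcs of `G` into mixed edge covers. -/
def IsMixedEdgeCoverPartition (G : MixedGraph V E A) {k : ℕ} (F : Fin k → Set (E ⊕ A)) : Prop :=
  (Pairwise fun i j => Disjoint (F i) (F j)) ∧ (⋃ i, F i) = Set.univ ∧
    ∀ i, G.IsMixedEdgeCover (F i)

end MixedGraph

namespace MixedGraph

variable {V E A : Type*}

/-! The core is the case of two covers. Record each vertex covered by an edge of a given colour as a
slot held by one such edge, so an edge holds at most two slots. By Edmonds' branching theorem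
(`exists_branching`), a recolouring of the edges still extends to two disjoint covers if the two
slots of every doubly covered vertex, and one slot of each colour in every other minimal set entered
by no arc, end up with different colours. Joining edges by these pairs gives a bipartite graph whose
components may be flipped independently. Counting slots and pairs leaves five types of imbalance per
component, up to sign; equal types cancel, so `exists_balanced_recolouring` balances edges and slots
at once. A branching has `|V|` minus its number of roots arcs, so balanced slots give balanced
branchings, and the surplus arcs are dealt out greedily. For `k` parts, a partition minimising sums
of squares lexicographically, edges first, then arcs and totals together, admits no improving
exchange of two parts. -/

theorem Reachable.mono {G : MixedGraph V E A} {B C : Set A} (hBC : B ⊆ C) {u v : V}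
    (h : G.Reachable B u v) : G.Reachable C u v :=
  Relation.ReflTransGen.mono (fun _ _ ⟨a, ha, h⟩ => ⟨a, hBC ha, h⟩) _ _ h

/-! ### Edmonds' theorem for two disjoint branchings -/

section Branching

variable [DecidableEq V]

/-- The arcs of `S` that enter the vertex set `X`. -/
def entering (G : MixedGraph V E A) (S : Finset A) (X : Finset V) : Finset A :=
  {a ∈ S | G.head a ∈ X ∧ G.tail a ∉ X}

theorem mem_entering {G : MixedGraph V E A} {S : Finset A} {X : Finset V} {a : A} :
    a ∈ G.entering S X ↔ a ∈ S ∧ G.head a ∈ X ∧ G.tail a ∉ X := by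
  simp [entering]

theorem card_entering_inter_add_card_entering_union_le (G : MixedGraph V E A) (S : Finset A)
    (X Y : Finset V) :
    (G.entering S (X ∩ Y)).card + (G.entering S (X ∪ Y)).card ≤
      (G.entering S X).card + (G.entering S Y).card := by
  simp only [entering, Finset.card_filter, ← Finset.sum_add_distrib]
  refine Finset.sum_le_sum fun a _ => ?_
  by_cases h1 : G.head a ∈ X <;> by_cases h2 : G.head a ∈ Y <;>
    by_cases h3 : G.tail a ∈ X <;> by_cases h4 : G.tail a ∈ Y <;> simp [h1, h2, h3, h4]

theorem Reachable.exists_entering {G : MixedGraph V E A} {B : Set A} {u v : V}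
    (h : G.Reachable B u v) {X : Finset V} (hu : u ∉ X) (hv : v ∈ X) :
    ∃ a ∈ B, G.head a ∈ X ∧ G.tail a ∉ X := by
  induction h with
  | refl => exact absurd hv hu
  | tail _ hbc ih =>
    obtain ⟨a, ha, rfl, rfl⟩ := hbc
    by_cases hb : G.tail a ∈ X
    · exact ih hb
    · exact ⟨a, ha, hv, hb⟩

variable [DecidableEq A]

theorem entering_erase_of_not_enters {G : MixedGraph V E A} {S : Finset A} {X : Finset V} {a : A}
    (h : ¬ (G.head a ∈ X ∧ G.tail a ∉ X)) : G.entering (S.erase a) X = G.entering S X := by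
  ext b
  simp only [mem_entering, Finset.mem_erase]
  constructor
  · rintro ⟨⟨_, h1⟩, h2⟩
    exact ⟨h1, h2⟩
  · rintro ⟨h1, h2⟩
    exact ⟨⟨fun hb => h (hb ▸ h2), h1⟩, h2⟩

theorem card_entering_le_card_entering_erase_add_one (G : MixedGraph V E A) (S : Finset A)
    (X : Finset V) (a : A) :
    (G.entering S X).card ≤ (G.entering (S.erase a) X).card + 1 := by
  have : G.entering (S.erase a) X = (G.entering S X).erase a := by
    ext b
    simp only [mem_entering, Finset.mem_erase]
    tauto
  rw [this]
  exact Nat.sub_le_iff_le_add.1 Finset.pred_card_le_card_erase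

variable [Fintype V]

/-- Lovász's choice of the next arc in the proof of Edmonds' disjoint branchings theorem. -/
theorem exists_arc_leaving (G : MixedGraph V E A) {S : Finset A} {U R : Finset V}
    (hR : ∀ X : Finset V, X.Nonempty → Disjoint X R → 1 ≤ (G.entering S X).card)
    (hU : ∀ X : Finset V, X.Nonempty → Disjoint X U → 1 ≤ (G.entering S X).card)
    (hUR : ∀ X : Finset V, X.Nonempty → Disjoint X U → Disjoint X R →
      2 ≤ (G.entering S X).card) (hne : U ≠ Finset.univ) :
    ∃ a ∈ S, G.tail a ∈ U ∧ G.head a ∉ U ∧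
      ∀ X : Finset V, G.head a ∈ X → Disjoint X R → 1 ≤ (G.entering (S.erase a) X).card := by
  -- Only sets entered by exactly one arc can be spoiled by deleting an arc. Take a minimal one not
  -- inside `U`.
  by_cases hcrit : ∃ X : Finset V,
      Disjoint X R ∧ (G.entering S X).card = 1 ∧ (X \ U).Nonempty
  · obtain ⟨X, hX⟩ := exists_minimal_of_wellFoundedLT _ hcrit
    obtain ⟨⟨hXR, hX1, hXU⟩, hmin⟩ := hX
    have h2 : 2 ≤ (G.entering S (X \ U)).card :=
      hUR _ hXU Finset.sdiff_disjoint (hXR.mono_left Finset.sdiff_subset)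
    -- An arc entering `X \ U` but not `X` must have its tail in `X ∩ U`.
    obtain ⟨a, ha, ha'⟩ := Finset.exists_mem_notMem_of_card_lt_card
      (show (G.entering S X).card < (G.entering S (X \ U)).card by omega)
    rw [mem_entering] at ha ha'
    obtain ⟨haS, hh, ht⟩ := ha
    rw [Finset.mem_sdiff] at hh ht
    have htX : G.tail a ∈ X := by tauto
    refine ⟨a, haS, by tauto, hh.2, fun Y hY hYR => ?_⟩
    by_cases htY : G.tail a ∈ Y
    · rw [entering_erase_of_not_enters (by tauto)]
      exact hR Y ⟨_, hY⟩ hYR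
    · have h3 := G.card_entering_le_card_entering_erase_add_one S Y a
      have h4 := hR Y ⟨_, hY⟩ hYR
      by_contra hlt
      have h5 := G.card_entering_inter_add_card_entering_union_le S X Y
      have h6 := hR (X ∪ Y) ⟨_, Finset.mem_union_right _ hY⟩
        (Finset.disjoint_union_left.2 ⟨hXR, hYR⟩)
      have h7 := hR (X ∩ Y) ⟨_, Finset.mem_inter.2 ⟨hh.1, hY⟩⟩
        (hXR.mono_left Finset.inter_subset_left)
      -- If deleting `a` spoiled `Y`, submodularity would make `X ∩ Y` critical too; it misses the
      -- tail of `a`, against minimality of `X`.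
      have h8 := hmin (y := X ∩ Y) ⟨hXR.mono_left Finset.inter_subset_left, by omega,
        ⟨G.head a, by simp [hh, hY]⟩⟩ Finset.inter_subset_left
      exact htY (Finset.mem_inter.1 (h8 htX)).2
  · push Not at hcrit
    have hc : (Uᶜ).Nonempty := by
      rw [Finset.nonempty_iff_ne_empty, Ne, Finset.compl_eq_empty_iff]
      exact hne
    obtain ⟨a, ha⟩ := Finset.card_pos.1 (hU Uᶜ hc (disjoint_compl_left))
    rw [mem_entering, Finset.mem_compl, Finset.mem_compl, not_not] at ha
    refine ⟨a, ha.1, ha.2.2, ha.2.1, fun X hX hXR => ?_⟩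
    have h1 := hR X ⟨_, hX⟩ hXR
    have h2 : (G.entering S X).card ≠ 1 := fun h => by
      have := hcrit X hXR h
      have h3 : G.head a ∈ X \ U := Finset.mem_sdiff.2 ⟨hX, ha.2.1⟩
      simp [this] at h3
    have h3 := G.card_entering_le_card_entering_erase_add_one S X a
    omega

/-- Edmonds' theorem on two disjoint branchings, first branching: it can be split off so that the
remaining arcs still enter each nonempty set avoiding `R`. -/
theorem exists_branching (G : MixedGraph V E A) {S : Finset A} {U R : Finset V}
    (hR : ∀ X : Finset V, X.Nonempty → Disjoint X R → 1 ≤ (G.entering S X).card)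
    (hU : ∀ X : Finset V, X.Nonempty → Disjoint X U → 1 ≤ (G.entering S X).card)
    (hUR : ∀ X : Finset V, X.Nonempty → Disjoint X U → Disjoint X R →
      2 ≤ (G.entering S X).card) :
    ∃ C ⊆ S, C.card + U.card = Fintype.card V ∧ (∀ v, ∃ u ∈ U, G.Reachable (C : Set A) u v) ∧
      ∀ X : Finset V, X.Nonempty → Disjoint X R → 1 ≤ (G.entering (S \ C) X).card := by
  induction hn : (Uᶜ).card generalizing U S with
  | zero =>
    have hU' : U = Finset.univ := by
      rwa [Finset.card_eq_zero, Finset.compl_eq_empty_iff] at hn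
    subst hU'
    exact ⟨∅, by simp, by simp, fun v => ⟨v, by simp, Relation.ReflTransGen.refl⟩, by simpa using hR⟩
  | succ n ih =>
    have hne : U ≠ Finset.univ := by
      rintro rfl
      simp at hn
    obtain ⟨a, haS, hat, hah, haX⟩ := G.exists_arc_leaving hR hU hUR hne
    have hcard : (insert (G.head a) U).card = U.card + 1 := Finset.card_insert_of_notMem hah
    have hcompl : ((insert (G.head a) U)ᶜ).card = n := by
      rw [Finset.card_compl] at hn ⊢
      omega
    have hsame : ∀ X : Finset V, Disjoint X (insert (G.head a) U) →
        G.entering (S.erase a) X = G.entering S X := fun X hX =>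
      entering_erase_of_not_enters fun h =>
        (Finset.disjoint_right.1 hX (Finset.mem_insert_self _ _)) h.1
    have hsub : ∀ X : Finset V, Disjoint X (insert (G.head a) U) → Disjoint X U := fun X hX =>
      hX.mono_right (Finset.subset_insert _ _)
    obtain ⟨C, hCS, hC1, hC2, hC3⟩ := ih (S := S.erase a) (U := insert (G.head a) U)
      (fun X hX hXR => by
        by_cases h : G.head a ∈ X
        · exact haX X h hXR
        · rw [entering_erase_of_not_enters (by tauto)]
          exact hR X hX hXR)
      (fun X hX hXU => by
        rw [hsame X hXU]
        exact hU X hX (hsub X hXU))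
      (fun X hX hXU hXR => by
        rw [hsame X hXU]
        exact hUR X hX (hsub X hXU) hXR) hcompl
    have haC : a ∉ C := fun h => Finset.notMem_erase a S (hCS h)
    refine ⟨insert a C, ?_, ?_, fun v => ?_, ?_⟩
    · exact Finset.insert_subset haS (hCS.trans (Finset.erase_subset _ _))
    · rw [Finset.card_insert_of_notMem haC]
      omega
    · have hCC : (C : Set A) ⊆ (insert a C : Finset A) := by
        exact_mod_cast Finset.subset_insert a C
      obtain ⟨u, hu, huv⟩ := hC2 v
      rw [Finset.mem_insert] at hu
      obtain rfl | hu := hu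
      · exact ⟨_, hat, Relation.ReflTransGen.head ⟨a, by simp, rfl, rfl⟩ (huv.mono hCC)⟩
      · exact ⟨u, hu, huv.mono hCC⟩
    · have : S \ insert a C = S.erase a \ C := by
        ext b
        simp only [Finset.mem_sdiff, Finset.mem_insert, Finset.mem_erase]
        tauto
      rwa [this]

end Branching

end MixedGraph

/-! ### Signed sums and balanced recolouring -/

section Balance

/-- The sign of a truth value. -/
def Bool.toSign (b : Bool) : ℤ := if b then 1 else -1

theorem Bool.toSign_beq (a b : Bool) : (a == b).toSign = a.toSign * b.toSign := by
  cases a <;> cases b <;> rfl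

theorem Bool.toSign_mul_self (a : Bool) : a.toSign * a.toSign = 1 := by
  cases a <;> rfl

theorem Finset.sum_toSign {ι : Type*} (s : Finset ι) (f : ι → Bool) :
    ∑ i ∈ s, (f i).toSign =
      ((s.filter fun i => f i = true).card : ℤ) - (s.filter fun i => f i = false).card := by
  simp only [Finset.card_filter, Nat.cast_sum, ← Finset.sum_sub_distrib]
  refine Finset.sum_congr rfl fun i _ => ?_
  cases f i <;> simp [Bool.toSign]

/-- Alternating signs cancel in pairs; `p` records the parity of `s`. -/
theorem Finset.exists_sum_toSign_eq {ι : Type*} (s : Finset ι) :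
    ∃ (σ : ι → Bool) (p : Bool), ∑ i ∈ s, (σ i).toSign = if p then 1 else 0 := by
  classical
  induction s using Finset.induction_on with
  | empty => exact ⟨fun _ => true, false, by simp⟩
  | insert i s hi ih =>
    obtain ⟨σ, p, h⟩ := ih
    refine ⟨Function.update σ i (!p), !p, ?_⟩
    rw [Finset.sum_insert hi, Function.update_self, Finset.sum_congr rfl
      (g := fun j => (σ j).toSign), h]
    · cases p <;> simp [Bool.toSign]
    · intro j hj
      rw [Function.update_of_ne (ne_of_mem_of_not_mem hj hi)]

/-- The vectors `(0, 0)`, `(0, 1)`, `(1, 0)`, `(1, 1)`, `(1, 2)`. -/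
def balanceType (j : Fin 5) : ℤ × ℤ := ![(0, 0), (0, 1), (1, 0), (1, 1), (1, 2)] j

/-- After cancellation at most one vector of each nonzero type survives, and `p` says which do. The
three bounds concern the first coordinate, the second, and their difference. -/
theorem exists_signs_balanceType : ∀ p₁ p₂ p₃ p₄ : Bool, ∃ t₁ t₂ t₃ t₄ : Bool,
    |t₂.toSign * (if p₂ then 1 else 0) + t₃.toSign * (if p₃ then 1 else 0) +
      t₄.toSign * (if p₄ then 1 else 0)| ≤ 1 ∧
    |t₁.toSign * (if p₁ then 1 else 0) + t₃.toSign * (if p₃ then 1 else 0) +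
      2 * (t₄.toSign * (if p₄ then 1 else 0))| ≤ 2 ∧
    |t₂.toSign * (if p₂ then 1 else 0) - t₁.toSign * (if p₁ then 1 else 0) -
      t₄.toSign * (if p₄ then 1 else 0)| ≤ 2 := by
  decide

/-- A finite family of vectors, each of them `(0, 0)`, `(0, 1)`, `(1, 0)`, `(1, 1)` or `(1, 2)`
up to sign, has a small signed sum. -/
theorem exists_signs_of_balanceType {ι : Type*} [Fintype ι] (x y : ι → ℤ)
    (h : ∀ i, ∃ (j : Fin 5) (b : Bool),
      x i = b.toSign * (balanceType j).1 ∧ y i = b.toSign * (balanceType j).2) :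
    ∃ σ : ι → Bool, |∑ i, (σ i).toSign * x i| ≤ 1 ∧ |∑ i, (σ i).toSign * y i| ≤ 2 ∧
      |∑ i, (σ i).toSign * x i - ∑ i, (σ i).toSign * y i| ≤ 2 := by
  choose j b hx hy using h
  choose σ p hp using fun t : Fin 5 => (Finset.univ.filter fun i => j i = t).exists_sum_toSign_eq
  obtain ⟨t₁, t₂, t₃, t₄, h1, h2, h3⟩ := exists_signs_balanceType (p 1) (p 2) (p 3) (p 4)
  let τ : Fin 5 → Bool := ![true, t₁, t₂, t₃, t₄]
  have key : ∀ w : Fin 5 → ℤ,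
      ∑ i, (b i == (σ (j i) i == τ (j i))).toSign * ((b i).toSign * w (j i)) =
        ∑ t, w t * ((τ t).toSign * if p t then 1 else 0) := by
    intro w
    rw [← Finset.sum_fiberwise (g := j)]
    refine Finset.sum_congr rfl fun t _ => ?_
    rw [← hp t, Finset.mul_sum, Finset.mul_sum]
    refine Finset.sum_congr rfl fun i hi => ?_
    rw [(Finset.mem_filter.1 hi).2, Bool.toSign_beq, Bool.toSign_beq]
    linear_combination (w t * (τ t).toSign * (σ t i).toSign) * (b i).toSign_mul_self
  refine ⟨fun i => b i == (σ (j i) i == τ (j i)), ?_⟩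
  simp only [hx, hy]
  rw [key fun t => (balanceType t).1, key fun t => (balanceType t).2]
  simp only [Fin.sum_univ_five]
  simp only [balanceType, τ, Matrix.cons_val, zero_mul, one_mul, zero_add, add_zero]
  refine ⟨by simpa using h1, by simpa using h2, ?_⟩
  convert h3 using 2
  ring

/-- Elements `e` are coloured by `col`, each has at most two slots, and some slots of true elements
are paired with slots of false ones. The elements can be recoloured so that paired slots still get
different colours and the colour classes are balanced, both for elements and for slots. -/
theorem exists_balanced_recolouring {E T P : Type*} [Fintype E] [Fintype T] [Finite P]
    (col : E → Bool) (l : T → E) (q : Bool → P → T)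
    (hl : ∀ e, Nat.card {t // l t = e} ≤ 2) (hq : ∀ b, Function.Injective (q b))
    (hcol : ∀ b p, col (l (q b p)) = b) :
    ∃ c : E → Bool, (∀ p, c (l (q true p)) ≠ c (l (q false p))) ∧
      |∑ e, (c e).toSign| ≤ 1 ∧ |∑ t, (c (l t)).toSign| ≤ 2 ∧
      |∑ e, (c e).toSign - ∑ t, (c (l t)).toSign| ≤ 2 := by
  classical
  have := Fintype.ofFinite P
  -- Paired slots join their edges. `col` properly 2-colours `H`, and flipping whole components
  -- keeps paired slots different.
  let H : SimpleGraph E :=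
    SimpleGraph.fromRel fun e f => ∃ p, e = l (q true p) ∧ f = l (q false p)
  have hadj : ∀ p, H.Adj (l (q true p)) (l (q false p)) := fun p => by
    rw [SimpleGraph.fromRel_adj]
    refine ⟨fun h => ?_, Or.inl ⟨p, rfl, rfl⟩⟩
    have h1 := hcol true p
    rw [h, hcol false p] at h1
    simp at h1
  let k : E → H.ConnectedComponent := H.connectedComponentMk
  have hk : ∀ b p, k (l (q b p)) = k (l (q true p)) := by
    rintro (_ | _) p
    · exact (SimpleGraph.ConnectedComponent.sound (hadj p).reachable).symm
    · rfl
  let a : H.ConnectedComponent → Bool → ℕ := fun C b =>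
    ((Finset.univ.filter fun e => k e = C).filter fun e => col e = b).card
  let s : H.ConnectedComponent → Bool → ℕ := fun C b =>
    ((Finset.univ.filter fun t => k (l t) = C).filter fun t => col (l t) = b).card
  let m : H.ConnectedComponent → ℕ := fun C =>
    (Finset.univ.filter fun p => k (l (q true p)) = C).card
  have hms : ∀ C b, m C ≤ s C b := fun C b => by
    refine Finset.card_le_card_of_injOn (q b) (fun p hp => ?_) ((hq b).injOn)
    simp only [Finset.coe_filter, Finset.mem_univ, true_and, Set.mem_ofPred_eq,
      Finset.mem_filter] at hp ⊢
    exact ⟨(hk b p).trans hp, hcol b p⟩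
  have hsa : ∀ C b, s C b ≤ 2 * a C b := fun C b => by
    refine Finset.card_le_mul_card_image_of_maps_to (f := l) (fun t ht => ?_) 2 fun e _ => ?_
    · simpa using ht
    · refine le_trans (Finset.card_le_card ?_)
        (by simpa [Nat.card_eq_fintype_card, Fintype.card_subtype] using hl e)
      intro t ht
      simp only [Finset.mem_filter, Finset.mem_univ, true_and] at ht ⊢
      exact ht.2
  -- A connected graph has at most one more vertex than edges, and each edge of `H` comes from a
  -- pair.
  have ham : ∀ C, a C true + a C false ≤ m C + 1 := fun C => by
    have h1 := C.connected_toSimpleGraph.card_vert_le_card_edgeSet_add_one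
    have h2 : Nat.card C = a C true + a C false := by
      have h3 : Nat.card C = (Finset.univ.filter fun e => k e = C).card := by
        rw [← Fintype.card_subtype, ← Nat.card_eq_fintype_card]
        rfl
      rw [h3, ← Finset.card_filter_add_card_filter_not (fun e => col e = true)]
      simp [a]
    have h4 : Nat.card C.toSimpleGraph.edgeSet ≤ m C := by
      have h5 : m C = Nat.card {p // k (l (q true p)) = C} := by
        rw [Nat.card_eq_fintype_card, Fintype.card_subtype]
      rw [h5]
      refine Nat.card_le_card_of_surjective (fun p => ⟨s(⟨l (q true p), p.2⟩,
        ⟨l (q false p), (hk false p).trans p.2⟩), ?_⟩) ?_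
      · rw [SimpleGraph.mem_edgeSet]
        exact hadj p
      · rintro ⟨e, he⟩
        induction e with
        | _ x y =>
          obtain ⟨x, hx⟩ := x
          obtain ⟨y, hy⟩ := y
          have hxy : H.Adj x y := he
          obtain ⟨-, ⟨p, rfl, rfl⟩ | ⟨p, rfl, rfl⟩⟩ := (SimpleGraph.fromRel_adj _ _ _).1 hxy
          · exact ⟨⟨p, hx⟩, rfl⟩
          · exact ⟨⟨p, hy⟩, Subtype.ext Sym2.eq_swap⟩
    omega
  have htype : ∀ C, ∃ (j : Fin 5) (b : Bool),
      (a C true - a C false : ℤ) = b.toSign * (balanceType j).1 ∧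
      (s C true - s C false : ℤ) = b.toSign * (balanceType j).2 := fun C => by
    have h1 := hms C true
    have h2 := hms C false
    have h3 := hsa C true
    have h4 := hsa C false
    have h5 := ham C
    -- From `m ≤ s ≤ 2a` for both colours and the connectivity bound: if the `a` agree, each `s` is
    -- `m` or `m + 1`; otherwise they differ by one, the smaller colour has `s = m`, and the larger
    -- has `s` between `m` and `m + 2`.
    have h6 : ((a C true - a C false : ℤ) = 0 ∧ ((s C true - s C false : ℤ) = 0 ∨
        (s C true - s C false : ℤ) = 1 ∨ (s C true - s C false : ℤ) = -1)) ∨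
        ((a C true - a C false : ℤ) = 1 ∧ ((s C true - s C false : ℤ) = 0 ∨
        (s C true - s C false : ℤ) = 1 ∨ (s C true - s C false : ℤ) = 2)) ∨
        ((a C true - a C false : ℤ) = -1 ∧ ((s C true - s C false : ℤ) = 0 ∨
        (s C true - s C false : ℤ) = -1 ∨ (s C true - s C false : ℤ) = -2)) := by
      omega
    obtain ⟨h, h' | h' | h'⟩ | ⟨h, h' | h' | h'⟩ | ⟨h, h' | h' | h'⟩ := h6 <;> rw [h, h']
    · exact ⟨0, true, by decide⟩
    · exact ⟨1, true, by decide⟩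
    · exact ⟨1, false, by decide⟩
    · exact ⟨2, true, by decide⟩
    · exact ⟨3, true, by decide⟩
    · exact ⟨4, true, by decide⟩
    · exact ⟨2, false, by decide⟩
    · exact ⟨3, false, by decide⟩
    · exact ⟨4, false, by decide⟩
  obtain ⟨σ, hσ⟩ := exists_signs_of_balanceType _ _ htype
  have hE : ∑ e, (σ (k e) == col e).toSign =
      ∑ C, (σ C).toSign * (a C true - a C false : ℤ) := by
    rw [← Finset.sum_fiberwise (g := k)]
    refine Finset.sum_congr rfl fun C _ => ?_
    rw [← Finset.sum_toSign, Finset.mul_sum]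
    refine Finset.sum_congr rfl fun e he => ?_
    rw [Bool.toSign_beq, (Finset.mem_filter.1 he).2]
  have hT : ∑ t, (σ (k (l t)) == col (l t)).toSign =
      ∑ C, (σ C).toSign * (s C true - s C false : ℤ) := by
    rw [← Finset.sum_fiberwise (g := fun t => k (l t))]
    refine Finset.sum_congr rfl fun C _ => ?_
    rw [← Finset.sum_toSign _ fun t => col (l t), Finset.mul_sum]
    refine Finset.sum_congr rfl fun t ht => ?_
    rw [Bool.toSign_beq, (Finset.mem_filter.1 ht).2]
  refine ⟨fun e => σ (k e) == col e, fun p => ?_, ?_⟩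
  · simp only [hk false p, hcol]
    cases σ (k (l (q true p))) <;> simp
  · rw [hE, hT]
    exact hσ

end Balance

/-! ### Distributing surplus arcs -/

theorem exists_two_mul_sub_le (n b : ℤ) (e : ℕ) (hn : |n| ≤ 1) (hb : |b| ≤ 2) (hnb : |n + b| ≤ 2) :
    ∃ x ≤ e, |b + 2 * x - e| ≤ 2 ∧ |n + (b + 2 * x - e)| ≤ 2 := by
  induction e with
  | zero => exact ⟨0, le_rfl, by simpa using hb, by simpa using hnb⟩
  | succ e ih =>
    obtain ⟨x, hx, h1, h2⟩ := ih
    rw [abs_le] at *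
    -- Each surplus arc goes to the side that is behind, and to the first side on a tie; `|n| ≤ 1`
    -- keeps the total in range.
    by_cases h : 0 < b + 2 * x - e
    · refine ⟨x, by omega, ?_, ?_⟩ <;> rw [abs_le] <;> push_cast <;> omega
    · refine ⟨x + 1, by omega, ?_, ?_⟩ <;> rw [abs_le] <;> push_cast <;> omega

theorem Finset.exists_balanced_split {α : Type*} [DecidableEq α] {S C D : Finset α} (hC : C ⊆ S)
    (hD : D ⊆ S \ C) (n : ℤ) (hn : |n| ≤ 1) (hb : |(C.card : ℤ) - D.card| ≤ 2)
    (hnb : |n + ((C.card : ℤ) - D.card)| ≤ 2) :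
    ∃ C' ⊆ S, C ⊆ C' ∧ D ⊆ S \ C' ∧ |(C'.card : ℤ) - (S \ C').card| ≤ 2 ∧
      |n + ((C'.card : ℤ) - (S \ C').card)| ≤ 2 := by
  have hCD : C ⊆ S \ D := fun a ha => Finset.mem_sdiff.2
    ⟨hC ha, fun h => (Finset.mem_sdiff.1 (hD h)).2 ha⟩
  have hDS : D ⊆ S := hD.trans Finset.sdiff_subset
  have h1 := Finset.card_le_card hCD
  rw [Finset.card_sdiff_of_subset hDS] at h1
  have h0 := Finset.card_le_card hDS
  obtain ⟨x, hx, h2, h3⟩ := exists_two_mul_sub_le n _ (S.card - D.card - C.card) hn hb hnb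
  obtain ⟨C', hCC', hC'S, hC'⟩ := Finset.exists_subsuperset_card_eq hCD
    (n := C.card + x) (by omega) (by rw [Finset.card_sdiff_of_subset hDS]; omega)
  have hC'S' : C' ⊆ S := hC'S.trans Finset.sdiff_subset
  have h4 := Finset.card_le_card hC'S
  rw [Finset.card_sdiff_of_subset hDS] at h4
  refine ⟨C', hC'S', hCC', fun a ha => Finset.mem_sdiff.2
    ⟨hDS ha, fun h => (Finset.mem_sdiff.1 (hC'S h)).2 ha⟩, ?_⟩
  have h5 : (C'.card : ℤ) - (S \ C').card = C.card - D.card + 2 * x -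
      (S.card - D.card - C.card : ℕ) := by
    rw [Finset.card_sdiff_of_subset hC'S']
    omega
  rw [h5]
  exact ⟨h2, h3⟩

/-! ### Rebalancing two covers -/

namespace MixedGraph

variable {V E A : Type*}

theorem exists_minimal_closed [Finite V] [DecidableEq V] {G : MixedGraph V E A} {S : Finset A}
    {X : Finset V} (hX : X.Nonempty) (hX0 : G.entering S X = ∅) :
    ∃ K ⊆ X, Minimal (fun K : Finset V => K.Nonempty ∧ G.entering S K = ∅) K := by
  obtain ⟨K, hK, hmin⟩ := exists_minimal_le_of_wellFoundedLT
    (fun K : Finset V => K.Nonempty ∧ G.entering S K = ∅) X ⟨hX, hX0⟩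
  exact ⟨K, hK, hmin⟩

/-- By submodularity, intersecting closed sets have a closed intersection. Disjointness of the
minimal ones makes the slot pairs disjoint later. -/
theorem eq_of_minimal_closed [DecidableEq V] {G : MixedGraph V E A} {S : Finset A}
    {K L : Finset V} (hK : Minimal (fun K : Finset V => K.Nonempty ∧ G.entering S K = ∅) K)
    (hL : Minimal (fun K : Finset V => K.Nonempty ∧ G.entering S K = ∅) L) {v : V}
    (hvK : v ∈ K) (hvL : v ∈ L) : K = L := by
  have h : G.entering S (K ∩ L) = ∅ := by
    have := G.card_entering_inter_add_card_entering_union_le S K L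
    rw [hK.prop.2, hL.prop.2] at this
    rw [← Finset.card_eq_zero]
    simp only [Finset.card_empty] at this
    omega
  have hne : (K ∩ L).Nonempty := ⟨v, Finset.mem_inter.2 ⟨hvK, hvL⟩⟩
  exact (hK.eq_of_le ⟨hne, h⟩ Finset.inter_subset_left).symm.trans
    (hL.eq_of_le ⟨hne, h⟩ Finset.inter_subset_right)

theorem card_ends_le_two (G : MixedGraph V E A) (e : E) :
    Nat.card {v // v ∈ G.ends e} ≤ 2 := by
  induction h : G.ends e with
  | _ x y =>
    have h1 : Nat.card {v // v ∈ s(x, y)} = ({x, y} : Set V).ncard := by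
      rw [← Nat.card_coe_set_eq]
      exact Nat.card_congr (Equiv.subtypeEquivRight fun v => by simp)
    rw [h1]
    exact (Set.ncard_insert_le x {y}).trans (by rw [Set.ncard_singleton])

/-- Two disjoint mixed edge covers can be repartitioned into two balanced ones. -/
theorem exists_balanced_pair_of_colouring [Fintype V] [Fintype E] [DecidableEq A]
    (G : MixedGraph V E A) {S : Finset A} (col : E → Bool) (B : Bool → Finset A)
    (hBS : ∀ b, B b ⊆ S) (hB : Disjoint (B true) (B false))
    (hcov : ∀ b v, ∃ e, col e = b ∧ ∃ u ∈ G.ends e, G.Reachable (B b : Set A) u v) :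
    ∃ (c : E → Bool) (C : Finset A), C ⊆ S ∧
      (∀ v, ∃ e, c e = true ∧ ∃ u ∈ G.ends e, G.Reachable (C : Set A) u v) ∧
      (∀ v, ∃ e, c e = false ∧ ∃ u ∈ G.ends e, G.Reachable (S \ C : Finset A) u v) ∧
      |∑ e, (c e).toSign| ≤ 1 ∧ |(C.card : ℤ) - (S \ C).card| ≤ 2 ∧
      |∑ e, (c e).toSign + ((C.card : ℤ) - (S \ C).card)| ≤ 2 := by
  classical
  -- Slots: a vertex with a colour covering it, held by the chosen edge `l t`.
  let T := {t : V × Bool // ∃ e, col e = t.2 ∧ t.1 ∈ G.ends e}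
  choose l hlcol hlend using fun t : T => t.2
  have hcut : ∀ b (X : Finset V), X.Nonempty →
      (∀ v ∈ X, ¬ ∃ e, col e = b ∧ v ∈ G.ends e) → (G.entering (B b) X).Nonempty := by
    rintro b X ⟨v, hv⟩ hX
    obtain ⟨e, he, u, hu, huv⟩ := hcov b v
    obtain ⟨a, ha, ha1, ha2⟩ := huv.exists_entering (fun h => hX u h ⟨e, he, hu⟩) hv
    exact ⟨a, mem_entering.2 ⟨ha, ha1, ha2⟩⟩
  let common : V → Prop := fun v => ∀ b, ∃ e, col e = b ∧ v ∈ G.ends e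
  let 𝒦 := {K : Finset V // Minimal (fun K : Finset V => K.Nonempty ∧ G.entering S K = ∅) K ∧
    ∀ v ∈ K, ¬ common v}
  -- No arc of `S` enters `K`, so both original covers must have an edge endpoint in it.
  have hmeet : ∀ b (K : 𝒦), ∃ v ∈ K.1, ∃ e, col e = b ∧ v ∈ G.ends e := by
    intro b K
    by_contra! h
    obtain ⟨a, ha⟩ := hcut b K.1 K.2.1.prop.1 fun v hv ⟨e, he, hve⟩ => h v hv e he hve
    rw [mem_entering] at ha
    have : a ∈ G.entering S K.1 := mem_entering.2 ⟨hBS b ha.1, ha.2⟩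
    simp [K.2.1.prop.2] at this
  choose f hfK hf using hmeet
  let q : Bool → {v // common v} ⊕ 𝒦 → T := fun b =>
    Sum.elim (fun v => ⟨(v.1, b), v.2 b⟩) (fun K => ⟨(f b K, b), hf b K⟩)
  have hq2 : ∀ b p, (q b p).1.2 = b := by
    rintro b (v | K) <;> rfl
  obtain ⟨c, hc, hc1, hc2, hc3⟩ := exists_balanced_recolouring col l q
    (by
      intro e
      refine le_trans ?_ (G.card_ends_le_two e)
      refine Nat.card_le_card_of_injective
        (fun t : {t // l t = e} => ⟨t.1.1.1, by
          have := hlend t.1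
          rwa [t.2] at this⟩) ?_
      rintro ⟨t, ht⟩ ⟨t', ht'⟩ h
      have h1 : t.1.1 = t'.1.1 := congrArg Subtype.val h
      have h2 : t.1.2 = t'.1.2 := by rw [← hlcol t, ← hlcol t', ht, ht']
      exact Subtype.ext (Subtype.ext (Prod.ext h1 h2)))
    (by
      rintro b (v | K) (v' | K') h
      · have h1 : v.1 = v'.1 := congrArg (fun t : T => t.1.1) h
        exact congrArg _ (Subtype.ext h1)
      · have h1 : v.1 = f b K' := congrArg (fun t : T => t.1.1) h
        exact absurd (h1 ▸ v.2) (K'.2.2 _ (hfK b K'))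
      · have h1 : f b K = v'.1 := congrArg (fun t : T => t.1.1) h
        exact absurd (h1 ▸ v'.2) (K.2.2 _ (hfK b K))
      · have h1 : f b K = f b K' := congrArg (fun t : T => t.1.1) h
        exact congrArg _ (Subtype.ext
          (eq_of_minimal_closed K.2.1 K'.2.1 (hfK b K) (h1 ▸ hfK b K'))))
    (fun b p => by rw [hlcol, hq2])
  have hsplit : ∀ b p, ∃ b', c (l (q b' p)) = b := by
    intro b p
    have := hc p
    by_cases h : c (l (q true p)) = b
    · exact ⟨true, h⟩
    · refine ⟨false, ?_⟩
      revert this h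
      cases c (l (q true p)) <;> cases c (l (q false p)) <;> cases b <;> simp
  let R : Bool → Finset V := fun b =>
    (Finset.univ.filter fun t : T => c (l t) = b).image fun t => t.1.1
  have hmemR : ∀ t : T, t.1.1 ∈ R (c (l t)) := fun t =>
    Finset.mem_image.2 ⟨t, Finset.mem_filter.2 ⟨Finset.mem_univ _, rfl⟩, rfl⟩
  -- The two slots of a common vertex are paired, so no vertex is counted twice in one colour.
  have hcardR : ∀ b, (R b).card = (Finset.univ.filter fun t : T => c (l t) = b).card := by
    intro b
    refine Finset.card_image_of_injOn fun t ht t' ht' h => ?_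
    have ht : c (l t) = b := (Finset.mem_filter.1 ht).2
    have ht' : c (l t') = b := (Finset.mem_filter.1 ht').2
    by_cases h2 : t.1.2 = t'.1.2
    · exact Subtype.ext (Prod.ext h h2)
    · exfalso
      have hcomm : common t.1.1 := by
        intro b'
        by_cases hb' : t.1.2 = b'
        · exact hb' ▸ t.2
        · have hb'' : t'.1.2 = b' := by
            revert hb' h2
            cases t.1.2 <;> cases t'.1.2 <;> cases b' <;> simp
          have h : t.1.1 = t'.1.1 := h
          rw [h, ← hb'']
          exact t'.2
      have hq : ∀ t₀ : T, t₀.1.1 = t.1.1 → q t₀.1.2 (Sum.inl ⟨t.1.1, hcomm⟩) = t₀ := fun t₀ h₀ =>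
        Subtype.ext (Prod.ext h₀.symm rfl)
      have hne := hc (Sum.inl ⟨t.1.1, hcomm⟩)
      have e1 := hq t rfl
      have e2 := hq t' h.symm
      cases h3 : t.1.2 <;> cases h4 : t'.1.2 <;> rw [h3] at e1 <;> rw [h4] at e2
      · exact h2 (h3.trans h4.symm)
      · rw [e1, e2, ht, ht'] at hne
        exact hne rfl
      · rw [e1, e2, ht, ht'] at hne
        exact hne rfl
      · exact h2 (h3.trans h4.symm)
  -- A set entered by no arc contains a minimal such set, hence both slots of some pair, one of
  -- which now has colour `b`.
  have hone : ∀ b (X : Finset V), X.Nonempty → Disjoint X (R b) →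
      1 ≤ (G.entering S X).card := by
    intro b X hX hXR
    rw [Nat.one_le_iff_ne_zero, Ne, Finset.card_eq_zero]
    intro hX0
    obtain ⟨K, hKX, hK⟩ := exists_minimal_closed hX hX0
    have hout : ∀ p, (∀ b', (q b' p).1.1 ∈ K) → False := by
      intro p hp
      obtain ⟨b', hb'⟩ := hsplit b p
      exact Finset.disjoint_left.1 hXR (hKX (hp b')) (hb' ▸ hmemR _)
    by_cases h : ∀ v ∈ K, ¬ common v
    · exact hout (Sum.inr ⟨K, hK, h⟩) fun b' => hfK b' _
    · push Not at h
      obtain ⟨v, hv, hvc⟩ := h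
      exact hout (Sum.inl ⟨v, hvc⟩) fun b' => hv
  -- Such an `X` contains no slot, so both original disjoint arc sets enter it.
  have htwo : ∀ X : Finset V, X.Nonempty → Disjoint X (R true) → Disjoint X (R false) →
      2 ≤ (G.entering S X).card := by
    intro X hX h1 h2
    have h3 : ∀ b, 1 ≤ (G.entering (B b) X).card := fun b => by
      refine Finset.card_pos.2 (hcut b X hX fun v hv hve => ?_)
      have h4 := hmemR ⟨(v, b), hve⟩
      generalize c (l ⟨(v, b), hve⟩) = b' at h4
      cases b'
      · exact Finset.disjoint_left.1 h2 hv h4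
      · exact Finset.disjoint_left.1 h1 hv h4
    have h5 : Disjoint (G.entering (B true) X) (G.entering (B false) X) :=
      hB.mono (Finset.filter_subset _ _) (Finset.filter_subset _ _)
    have h6 : G.entering (B true) X ∪ G.entering (B false) X ⊆ G.entering S X :=
      Finset.union_subset (Finset.filter_subset_filter _ (hBS true))
        (Finset.filter_subset_filter _ (hBS false))
    have h7 := Finset.card_le_card h6
    rw [Finset.card_union_of_disjoint h5] at h7
    have := h3 true
    have := h3 false
    omega
  obtain ⟨C, hCS, hC, hCcov, hCcut⟩ := G.exists_branching (hone false) (hone true) htwo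
  have hempty : ∀ X : Finset V, X.Nonempty → ¬ Disjoint X Finset.univ := by
    rintro X ⟨v, hv⟩ h
    exact Finset.disjoint_left.1 h hv (Finset.mem_univ v)
  -- Taking every vertex as a root makes the requirement on the leftover arcs vacuous.
  obtain ⟨D, hDS, hD, hDcov, -⟩ := G.exists_branching (S := S \ C) (U := R false)
    (R := Finset.univ) (fun X hX h => absurd h (hempty X hX)) hCcut
    (fun X hX _ h => absurd h (hempty X hX))
  have hr : (C.card : ℤ) - D.card = - ∑ t, (c (l t)).toSign := by
    rw [Finset.sum_toSign _ fun t => c (l t), ← hcardR, ← hcardR]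
    omega
  obtain ⟨C', hC'S, hCC', hDC', h1, h2⟩ := Finset.exists_balanced_split hCS hDS _ hc1
    (by rwa [hr, abs_neg]) (by rwa [hr, ← sub_eq_add_neg])
  have hcov' : ∀ b (F F' : Finset A), F ⊆ F' →
      (∀ v, ∃ u ∈ R b, G.Reachable (F : Set A) u v) →
      ∀ v, ∃ e, c e = b ∧ ∃ u ∈ G.ends e, G.Reachable (F' : Set A) u v := by
    intro b F F' hFF' hF v
    obtain ⟨u, hu, huv⟩ := hF v
    obtain ⟨t, ht, rfl⟩ := Finset.mem_image.1 hu
    exact ⟨l t, (Finset.mem_filter.1 ht).2, _, hlend t, huv.mono (by exact_mod_cast hFF')⟩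
  exact ⟨c, C', hC'S, hcov' true C C' hCC' hCcov, hcov' false D _ hDC' hDcov, hc1, h1, h2⟩

end MixedGraph

/-! ### From colourings back to sets of edges and arcs -/

namespace MixedGraph

variable {V E A : Type*}

/-- The mixed graph with the edges in `N` and all arcs. -/
def restrictEdges (G : MixedGraph V E A) (N : Set E) : MixedGraph V N A where
  ends e := G.ends e
  tail := G.tail
  head := G.head
  ends_not_isDiag e := G.ends_not_isDiag e
  tail_ne_head := G.tail_ne_head

theorem edgePart_image_union_image (N : Set E) (B : Set A) :
    edgePart (Sum.inl '' N ∪ Sum.inr '' B) = N := by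
  ext e
  simp [edgePart]

theorem arcPart_image_union_image (N : Set E) (B : Set A) :
    arcPart (Sum.inl '' N ∪ Sum.inr '' B) = B := by
  ext e
  simp [arcPart]

theorem image_edgePart_union_image_arcPart (F : Set (E ⊕ A)) :
    Sum.inl '' edgePart F ∪ Sum.inr '' arcPart F = F := by
  ext (e | a) <;> simp [edgePart, arcPart]

theorem ncard_edgePart_add_ncard_arcPart [Finite E] [Finite A] (F : Set (E ⊕ A)) :
    (edgePart F).ncard + (arcPart F).ncard = F.ncard := by
  conv_rhs => rw [← image_edgePart_union_image_arcPart F]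
  rw [Set.ncard_union_eq, Set.ncard_image_of_injective _ Sum.inl_injective,
    Set.ncard_image_of_injective _ Sum.inr_injective]
  rw [Set.disjoint_left]
  rintro _ ⟨e, -, rfl⟩ ⟨a, -, h⟩
  simp at h

theorem ncard_edgePart_union [Finite E] {F F' : Set (E ⊕ A)} (h : Disjoint F F') :
    (edgePart (F ∪ F')).ncard = (edgePart F).ncard + (edgePart F').ncard := by
  exact Set.ncard_union_eq (h.preimage Sum.inl)

theorem ncard_arcPart_union [Finite A] {F F' : Set (E ⊕ A)} (h : Disjoint F F') :
    (arcPart (F ∪ F')).ncard = (arcPart F).ncard + (arcPart F').ncard := by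
  exact Set.ncard_union_eq (h.preimage Sum.inr)

theorem exists_balanced_pair [Finite V] [Finite E] [Finite A] (G : MixedGraph V E A)
    {F₁ F₂ : Set (E ⊕ A)} (hF : Disjoint F₁ F₂) (h₁ : G.IsMixedEdgeCover F₁)
    (h₂ : G.IsMixedEdgeCover F₂) :
    ∃ F₁' F₂' : Set (E ⊕ A), Disjoint F₁' F₂' ∧ F₁' ∪ F₂' = F₁ ∪ F₂ ∧
      G.IsMixedEdgeCover F₁' ∧ G.IsMixedEdgeCover F₂' ∧
      |((edgePart F₁').ncard : ℤ) - (edgePart F₂').ncard| ≤ 1 ∧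
      |((arcPart F₁').ncard : ℤ) - (arcPart F₂').ncard| ≤ 2 ∧
      |(F₁'.ncard : ℤ) - F₂'.ncard| ≤ 2 := by
  classical
  have := Fintype.ofFinite V
  have := Fintype.ofFinite A
  let N := edgePart (F₁ ∪ F₂)
  have := Fintype.ofFinite N
  let S : Finset A := (arcPart (F₁ ∪ F₂)).toFinset
  let B : Bool → Finset A := fun b => (arcPart (if b then F₁ else F₂)).toFinset
  obtain ⟨c, C, hCS, hc₁, hc₂, hn, hb, hnb⟩ :=
    (G.restrictEdges N).exists_balanced_pair_of_colouring (S := S)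
      (fun e => decide (Sum.inl e.1 ∈ F₁)) B
      (by
        rintro (_ | _) <;> intro a ha
        · have ha : a ∈ arcPart F₂ := Set.mem_toFinset.1 ha
          exact Set.mem_toFinset.2 (Or.inr ha)
        · have ha : a ∈ arcPart F₁ := Set.mem_toFinset.1 ha
          exact Set.mem_toFinset.2 (Or.inl ha))
      (Set.disjoint_toFinset.2 (hF.preimage Sum.inr))
      (by
        rintro (_ | _) v
        · obtain ⟨e, he, u, hu, huv⟩ := h₂ v
          refine ⟨⟨e, Or.inr he⟩, decide_eq_false (Set.disjoint_right.1 hF he), u, hu, ?_⟩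
          rw [Set.coe_toFinset]
          exact huv
        · obtain ⟨e, he, u, hu, huv⟩ := h₁ v
          refine ⟨⟨e, Or.inl he⟩, decide_eq_true he, u, hu, ?_⟩
          rw [Set.coe_toFinset]
          exact huv)
  let P : Bool → Finset A → Set (E ⊕ A) := fun b D =>
    Sum.inl '' (Subtype.val '' {e : N | c e = b}) ∪ Sum.inr '' (D : Set A)
  have hcov : ∀ b (D : Finset A), (∀ v, ∃ e, c e = b ∧ ∃ u ∈ (G.restrictEdges N).ends e,
      (G.restrictEdges N).Reachable (D : Set A) u v) → G.IsMixedEdgeCover (P b D) := by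
    intro b D h v
    obtain ⟨e, he, u, hu, huv⟩ := h v
    simp only [P, edgePart_image_union_image, arcPart_image_union_image]
    exact ⟨e.1, ⟨e, he, rfl⟩, u, hu, huv⟩
  have hE : ∀ b (D : Finset A),
      (edgePart (P b D)).ncard = (Finset.univ.filter fun e => c e = b).card := by
    intro b D
    simp only [P, edgePart_image_union_image]
    rw [Set.ncard_image_of_injective _ Subtype.val_injective, ← Set.ncard_coe_finset]
    simp
  have hA : ∀ b (D : Finset A), (arcPart (P b D)).ncard = D.card := by
    intro b D
    simp only [P, arcPart_image_union_image]
    exact Set.ncard_coe_finset D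
  rw [Finset.sum_toSign] at hn hnb
  have hSF : ∀ a, a ∈ S ↔ Sum.inr a ∈ F₁ ∪ F₂ := fun a => Set.mem_toFinset
  refine ⟨P true C, P false (S \ C), ?_, ?_, hcov _ _ hc₁, hcov _ _ hc₂, ?_, ?_, ?_⟩
  · rw [Set.disjoint_left]
    rintro (e | a) h h'
    · simp only [P, Set.mem_union, Set.mem_image, Sum.inl.injEq, Subtype.exists,
        exists_eq_right, reduceCtorEq, and_false, exists_false, or_false, exists_and_right,
        Set.mem_ofPred_eq] at h h'
      obtain ⟨he, h⟩ := h
      obtain ⟨_, h'⟩ := h'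
      rw [h] at h'
      simp at h'
    · simp [P] at h h'
      exact h'.2 h
  · ext (e | a)
    · have : Sum.inl e ∈ F₁ ∪ F₂ ↔ e ∈ N := Iff.rfl
      rw [this]
      by_cases he : e ∈ N
      · have : c ⟨e, he⟩ = true ∨ c ⟨e, he⟩ = false := by cases c ⟨e, he⟩ <;> simp
        simp [P, he, this]
      · simp [P, he]
    · rw [← hSF]
      have := @hCS a
      simp only [P, Set.mem_union, Set.mem_image, Sum.inr.injEq, reduceCtorEq, and_false,
        exists_false, false_or, Finset.mem_coe, exists_eq_right, Finset.mem_sdiff]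
      tauto
  · rwa [hE, hE]
  · rwa [hA, hA]
  · rw [← ncard_edgePart_add_ncard_arcPart, ← ncard_edgePart_add_ncard_arcPart, hE, hE, hA, hA]
    convert hnb using 2
    push_cast
    ring

end MixedGraph

/-! ### Exchanging two parts and minimising the potential -/

namespace MixedGraph

variable {V E A : Type*}

/-- Replacing two parts of a partition by another partition of their union. -/
theorem IsMixedEdgeCoverPartition.update {G : MixedGraph V E A} {k : ℕ} {F : Fin k → Set (E ⊕ A)}
    (hF : G.IsMixedEdgeCoverPartition F) {i j : Fin k} (hij : i ≠ j) {X Y : Set (E ⊕ A)}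
    (hXY : Disjoint X Y) (hun : X ∪ Y = F i ∪ F j) (hX : G.IsMixedEdgeCover X)
    (hY : G.IsMixedEdgeCover Y) :
    G.IsMixedEdgeCoverPartition (Function.update (Function.update F i X) j Y) := by
  obtain ⟨hd, hu, hc⟩ := hF
  have hi : Function.update (Function.update F i X) j Y i = X := by
    rw [Function.update_of_ne hij, Function.update_self]
  have hj : Function.update (Function.update F i X) j Y j = Y := Function.update_self ..
  have ho : ∀ l, l ≠ i → l ≠ j → Function.update (Function.update F i X) j Y l = F l :=
    fun l h1 h2 => by rw [Function.update_of_ne h2, Function.update_of_ne h1]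
  generalize Function.update (Function.update F i X) j Y = F' at hi hj ho
  have hdisj : ∀ l, l ≠ i → l ≠ j → Disjoint (X ∪ Y) (F l) := fun l h1 h2 => by
    rw [hun]
    exact Set.disjoint_union_left.2 ⟨hd h1.symm, hd h2.symm⟩
  refine ⟨fun l m hlm => ?_, ?_, fun l => ?_⟩
  · change Disjoint (F' l) (F' m)
    by_cases hli : l = i
    · subst hli
      rw [hi]
      by_cases hmj : m = j
      · subst hmj
        rwa [hj]
      · rw [ho m hlm.symm hmj]
        exact (hdisj m hlm.symm hmj).mono_left Set.subset_union_left
    · by_cases hlj : l = j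
      · subst hlj
        rw [hj]
        by_cases hmi : m = i
        · subst hmi
          rw [hi]
          exact hXY.symm
        · rw [ho m hmi hlm.symm]
          exact (hdisj m hmi hlm.symm).mono_left Set.subset_union_right
      · rw [ho l hli hlj]
        by_cases hmi : m = i
        · subst hmi
          rw [hi]
          exact ((hdisj l hli hlj).mono_left Set.subset_union_left).symm
        · by_cases hmj : m = j
          · subst hmj
            rw [hj]
            exact ((hdisj l hli hlj).mono_left Set.subset_union_right).symm
          · rw [ho m hmi hmj]
            exact hd hlm
  · rw [Set.eq_univ_iff_forall] at hu ⊢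
    intro x
    obtain ⟨l, hl⟩ := Set.mem_iUnion.1 (hu x)
    have hij' : x ∈ F i ∪ F j → x ∈ ⋃ l, F' l := by
      rw [← hun]
      rintro (h | h)
      · exact Set.mem_iUnion.2 ⟨i, hi ▸ h⟩
      · exact Set.mem_iUnion.2 ⟨j, hj ▸ h⟩
    by_cases hli : l = i
    · exact hij' (Or.inl (hli ▸ hl))
    · by_cases hlj : l = j
      · exact hij' (Or.inr (hlj ▸ hl))
      · exact Set.mem_iUnion.2 ⟨l, (ho l hli hlj).symm ▸ hl⟩
  · by_cases hli : l = i
    · rw [hli, hi]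
      exact hX
    · by_cases hlj : l = j
      · rw [hlj, hj]
        exact hY
      · rw [ho l hli hlj]
        exact hc l

end MixedGraph

theorem Finset.sum_update_update {ι α : Type*} [Fintype ι] [DecidableEq ι] (F : ι → α) {i j : ι}
    (hij : i ≠ j) (X Y : α) (φ : α → ℕ) :
    ∑ l, φ (Function.update (Function.update F i X) j Y l) + (φ (F i) + φ (F j)) =
      ∑ l, φ (F l) + (φ X + φ Y) := by
  have h : ∀ F' : ι → α, ∑ l, φ (F' l) =
      φ (F' i) + (φ (F' j) + ∑ l ∈ (Finset.univ.erase i).erase j, φ (F' l)) := fun F' => by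
    rw [Finset.add_sum_erase _ (fun l => φ (F' l)) (by simp [hij.symm]),
      Finset.add_sum_erase _ (fun l => φ (F' l)) (by simp)]
  rw [h, h F, Function.update_self, Function.update_of_ne hij, Function.update_self]
  have : ∑ l ∈ (Finset.univ.erase i).erase j, φ (Function.update (Function.update F i X) j Y l) =
      ∑ l ∈ (Finset.univ.erase i).erase j, φ (F l) := by
    refine Finset.sum_congr rfl fun l hl => ?_
    simp only [Finset.mem_erase, Finset.mem_univ, and_true] at hl
    rw [Function.update_of_ne hl.1, Function.update_of_ne hl.2]
  rw [this]
  ring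

/-- Equal sums force differences of equal parity, which absorbs the slack of one in `hcd`. -/
theorem Nat.sq_add_sq_le_of_abs_sub_le {a b c d : ℕ} {r : ℤ} (h : a + b = c + d)
    (hab : |(a : ℤ) - b| ≤ r) (hcd : r ≤ |(c : ℤ) - d| + 1) : a ^ 2 + b ^ 2 ≤ c ^ 2 + d ^ 2 := by
  have h0 : |(a : ℤ) - b| ≤ |(c : ℤ) - d| := by
    obtain h1 | h1 := abs_cases ((a : ℤ) - b) <;> obtain h2 | h2 := abs_cases ((c : ℤ) - d) <;>
      omega
  have h1 := sq_le_sq.2 h0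
  have h2 : (a + b : ℤ) ^ 2 = (c + d) ^ 2 := by
    congr 1
    exact_mod_cast h
  zify
  linarith

theorem Nat.sq_add_sq_lt_of_abs_sub_lt {a b c d : ℕ} (h : a + b = c + d)
    (hab : |(a : ℤ) - b| < |(c : ℤ) - d|) : a ^ 2 + b ^ 2 < c ^ 2 + d ^ 2 := by
  have h1 := sq_lt_sq.2 hab
  have h2 : (a + b : ℤ) ^ 2 = (c + d) ^ 2 := by
    congr 1
    exact_mod_cast h
  zify
  linarith

theorem theorem4 {V E A : Type*} [Finite V] [Finite E] [Finite A]
    (G : MixedGraph V E A) (k : ℕ)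
    (hG : ∃ F : Fin k → Set (E ⊕ A), G.IsMixedEdgeCoverPartition F) :
    ∃ F : Fin k → Set (E ⊕ A), G.IsMixedEdgeCoverPartition F ∧
      ∀ i j : Fin k,
        |((F i).ncard : ℤ) - ((F j).ncard : ℤ)| ≤ 2 ∧
        |((MixedGraph.edgePart (F i)).ncard : ℤ) - ((MixedGraph.edgePart (F j)).ncard : ℤ)| ≤ 1 ∧
        |((MixedGraph.arcPart (F i)).ncard : ℤ) - ((MixedGraph.arcPart (F j)).ncard : ℤ)| ≤ 2 := by
  let φ : Set (E ⊕ A) → ℕ := fun X => (MixedGraph.edgePart X).ncard ^ 2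
  let ψ : Set (E ⊕ A) → ℕ := fun X => (MixedGraph.arcPart X).ncard ^ 2 + X.ncard ^ 2
  obtain ⟨F, hF, hmin⟩ := exists_minimalFor_of_wellFoundedLT
    (fun F : Fin k → Set (E ⊕ A) => G.IsMixedEdgeCoverPartition F)
    (fun F => toLex (∑ l, φ (F l), ∑ l, ψ (F l))) hG
  refine ⟨F, hF, fun i j => ?_⟩
  by_cases hij : i = j
  · subst hij
    simp
  by_contra hbad
  obtain ⟨X, Y, hXY, hun, hX, hY, hn, hb, hf⟩ :=
    G.exists_balanced_pair (hF.1 hij) (hF.2.2 i) (hF.2.2 j)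
  have hle := hmin (hF.update hij hXY hun hX hY)
  have hφ := Finset.sum_update_update F hij X Y φ
  have hψ := Finset.sum_update_update F hij X Y ψ
  have hN := MixedGraph.ncard_edgePart_union hXY
  have hA := MixedGraph.ncard_arcPart_union hXY
  rw [hun, MixedGraph.ncard_edgePart_union (hF.1 hij)] at hN
  rw [hun, MixedGraph.ncard_arcPart_union (hF.1 hij)] at hA
  have e1 := MixedGraph.ncard_edgePart_add_ncard_arcPart X
  have e2 := MixedGraph.ncard_edgePart_add_ncard_arcPart Y
  have e3 := MixedGraph.ncard_edgePart_add_ncard_arcPart (F i)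
  have e4 := MixedGraph.ncard_edgePart_add_ncard_arcPart (F j)
  have hf' : X.ncard + Y.ncard = (F i).ncard + (F j).ncard := by omega
  have hφle : φ X + φ Y ≤ φ (F i) + φ (F j) :=
    Nat.sq_add_sq_le_of_abs_sub_le hN.symm hn (by simp)
  have hlt : φ X + φ Y < φ (F i) + φ (F j) ∨ ψ X + ψ Y < ψ (F i) + ψ (F j) := by
    by_cases h1 : |((MixedGraph.edgePart (F i)).ncard : ℤ) - (MixedGraph.edgePart (F j)).ncard| ≤ 1
    · right
      have h1' := abs_le.1 h1
      by_cases h2 : |((MixedGraph.arcPart (F i)).ncard : ℤ) - (MixedGraph.arcPart (F j)).ncard| ≤ 2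
      · have h3 : 2 < |((F i).ncard : ℤ) - (F j).ncard| := not_le.1 fun h3 => hbad ⟨h3, h1, h2⟩
        have h4 := Nat.sq_add_sq_lt_of_abs_sub_lt hf' (hf.trans_lt h3)
        -- The edge counts differ by at most 1, so a total difference above 2 forces an arc
        -- difference of at least 2; the arc term cannot grow.
        have h5 := Nat.sq_add_sq_le_of_abs_sub_le hA.symm hb (by
          rw [← sub_le_iff_le_add, le_abs]
          rw [lt_abs] at h3
          omega)
        simp only [ψ]
        omega
      · have h3 := not_le.1 h2
        have h4 := Nat.sq_add_sq_lt_of_abs_sub_lt hA.symm (hb.trans_lt h3)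
        have h5 := Nat.sq_add_sq_le_of_abs_sub_le hf' hf (by
          rw [← sub_le_iff_le_add, le_abs]
          rw [lt_abs] at h3
          omega)
        simp only [ψ]
        omega
    · exact Or.inl (Nat.sq_add_sq_lt_of_abs_sub_lt hN.symm (hn.trans_lt (not_le.1 h1)))
  have hlex : toLex (∑ l, φ (Function.update (Function.update F i X) j Y l),
      ∑ l, ψ (Function.update (Function.update F i X) j Y l)) <
        toLex (∑ l, φ (F l), ∑ l, ψ (F l)) := by
    rw [Prod.Lex.toLex_lt_toLex]
    simp only
    omega
  exact absurd (hle hlex.le) (not_le_of_gt hlex)
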